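/- Let $\mathfrak{F}\mathbf{Set}$ be the category of filters of (small) sets. Its objects are pairs $(C,(\mathcal F_i)_{i\in I})$, where $C$ is a set and $(\mathcal F_i)_{i\in I}$ is a filter base on $C$: a family of subsets of $C$, indexed by an inhabited set $I$, such that for all $i,j\in I$ there is $k\in I$ with $\mathcal F_k\subseteq\mathcal F_i\cap\mathcal F_j$ (non-proper filters, for which some $\mathcal F_i=\emptyset$, are allowed). Morphisms $(C,\mathcal F_I)\to(D,\mathcal G_J)$ are germs of continuous partial maps: maps $\alpha:\mathcal F_i\to D$ defined on a base set, such that every $\alpha^{-1}(\mathcal G_j)$ contains some $\mathcal F_{i'}$; two of them are identified if they agree on some base set contained in both domains. A set $S$ is identified with the filter $(S,\{S\})$. A family $\{\beta_k:\mathcal G_k\to\mathcal F\}_{k}$ is called jointly covering if, for all choices of base sets $\mathcal G_{k,j_k}$ of the $\mathcal G_k$, the union of the images $\beta_k(\mathcal G_{k,j_k})$ contains a base set of $\mathcal F$. Let $K$ be the Grothendieck topology on $\mathfrak{F}\mathbf{Set}$ whose covers are the finite (possibly empty) jointly covering families, and $K_1\subseteq K$ the topology whose covers are the single covering morphisms $\{\mathcal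 G\to\mathcal F\}$, together with the empty cover of the initial object (that is, of the non-proper filters). Let $\mathcal N=\mathrm{Sh}(\mathfrak{F}\mathbf{Set},K)$ and $\mathcal U=\mathrm{Sh}(\mathfrak{F}\mathbf{Set},K_1)$, where sheaves take values in a category of sets large enough for $\mathfrak{F}\mathbf{Set}$ to be a small site. The topology $K_1$ is subcanonical; let $\mathbf y:\mathfrak{F}\mathbf{Set}\to\mathcal U$ be the Yoneda embedding, let $2:=1+1$ in $\mathcal U$, and let $m:2\to\mathbf y2$ be the morphism whose two components are the global elements of $\mathbf y 2$ given by the two elements of the set $2$. A local operator on $\mathcal U$ is a morphism $j:\Omega\to\Omega$ with $j\circ\mathrm{true}=\mathrm{true}$, $j\circ j=j$ and $j\circ\wedge=\wedge\circ(j\times j)$; local operators are ordered by $j\le j'$ iff $j\wedge j'=j$. A monomorphism is $j$-dense if its $j$-closure is the maximal subobject, and $\mathrm{sh}_j(\mathcal U)$ is the full subcategory of those objects $F$ of $\mathcal U$ such that morphisms into $F$ extend uniquely along $j$-dense monomorphisms. **Proposition.** The morphism $m:2\to\mathbf y2$ is a monomorphism. There is a smallest local operator $j$ on $\mathcal U$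 such that $m$ is $j$-dense, and for this $j$ there is an equivalence $\mathrm{sh}_j(\mathcal U)\simeq\mathcal N$, compatible up to natural isomorphism with the inclusions of $\mathrm{sh}_j(\mathcal U)$ and of $\mathcal N$ in $\mathcal U$. -/

import Mathlib

open CategoryTheory CategoryTheory.Limits Opposite

universe u v w

/-! ### The filter category over the category of sets -/

/-- An object of the filter category over sets: a set together with an inhabited indexed filter base
of subsets. The base may contain the empty set (non-proper filters are allowed). -/
structure FilterSet : Type (u + 1) where
  carrier : Type u
  Idx : Type u
  inhabited : Nonempty Idx
  base : Idx → Set carrier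
  directed : ∀ i j : Idx, ∃ k, base k ⊆ base i ∩ base j

namespace FilterSet

/-- A continuous partial map `X ⇀ Y`, defined on a base set of `X`: the preimage of every base set
of `Y` contains a base set of `X`. -/
structure PartialMap (X Y : FilterSet.{u}) where
  dom : X.Idx
  toFun : X.base dom → Y.carrier
  continuous : ∀ j : Y.Idx, ∃ i : X.Idx, ∀ x ∈ X.base i,
    ∃ h : x ∈ X.base dom, toFun ⟨x, h⟩ ∈ Y.base j

namespace PartialMap

variable {X Y Z W : FilterSet.{u}}

/-- Two continuous partial maps have the same germ if they are both defined, and agree, on some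
base set. -/
def Equiv (f g : PartialMap X Y) : Prop :=
  ∃ k : X.Idx, ∀ x ∈ X.base k,
    ∃ (hf : x ∈ X.base f.dom) (hg : x ∈ X.base g.dom), f.toFun ⟨x, hf⟩ = g.toFun ⟨x, hg⟩

theorem equiv_refl (f : PartialMap X Y) : f.Equiv f :=
  ⟨f.dom, fun _ hx => ⟨hx, hx, rfl⟩⟩

theorem Equiv.symm {f g : PartialMap X Y} (h : f.Equiv g) : g.Equiv f := by
  obtain ⟨k, hk⟩ := h
  exact ⟨k, fun x hx => let ⟨a, b, e⟩ := hk x hx; ⟨b, a, e.symm⟩⟩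

theorem Equiv.trans {f g h : PartialMap X Y} (h₁ : f.Equiv g) (h₂ : g.Equiv h) : f.Equiv h := by
  obtain ⟨k, hk⟩ := h₁
  obtain ⟨l, hl⟩ := h₂
  obtain ⟨n, hn⟩ := X.directed k l
  refine ⟨n, fun x hx => ?_⟩
  obtain ⟨a, b, e⟩ := hk x (hn hx).1
  obtain ⟨_, c, e'⟩ := hl x (hn hx).2
  exact ⟨a, c, e.trans e'⟩

instance setoid (X Y : FilterSet.{u}) : Setoid (PartialMap X Y) where
  r := Equiv
  iseqv := ⟨equiv_refl, Equiv.symm, Equiv.trans⟩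

/-- The identity, defined on an arbitrary base set. -/
noncomputable def id (X : FilterSet.{u}) : PartialMap X X where
  dom := X.inhabited.some
  toFun x := x.1
  continuous j := by
    obtain ⟨k, hk⟩ := X.directed X.inhabited.some j
    exact ⟨k, fun x hx => ⟨(hk hx).1, (hk hx).2⟩⟩

/-- The composite, defined on a base set which `f` maps into the domain of `g`. -/
noncomputable def comp (f : PartialMap X Y) (g : PartialMap Y Z) : PartialMap X Z where
  dom := (f.continuous g.dom).choose
  toFun x := g.toFun ⟨f.toFun ⟨x.1, ((f.continuous g.dom).choose_spec x.1 x.2).choose⟩,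
    ((f.continuous g.dom).choose_spec x.1 x.2).choose_spec⟩
  continuous j := by
    obtain ⟨k, hk⟩ := g.continuous j
    obtain ⟨i, hi⟩ := f.continuous k
    obtain ⟨n, hn⟩ := X.directed i (f.continuous g.dom).choose
    refine ⟨n, fun x hx => ⟨(hn hx).2, ?_⟩⟩
    obtain ⟨_, h₂⟩ := hi x (hn hx).1
    exact (hk _ h₂).2

theorem comp_congr {f f' : PartialMap X Y} {g g' : PartialMap Y Z} (hf : f.Equiv f')
    (hg : g.Equiv g') : (f.comp g).Equiv (f'.comp g') := by
  obtain ⟨k, hk⟩ := hf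
  obtain ⟨l, hl⟩ := hg
  obtain ⟨i, hi⟩ := f.continuous l
  obtain ⟨n, hn⟩ := X.directed k i
  obtain ⟨n₁, hn₁⟩ := X.directed (f.comp g).dom (f'.comp g').dom
  obtain ⟨p, hp⟩ := X.directed n n₁
  refine ⟨p, fun x hx => ⟨(hn₁ (hp hx).2).1, (hn₁ (hp hx).2).2, ?_⟩⟩
  obtain ⟨_, _, e⟩ := hk x (hn (hp hx).1).1
  obtain ⟨_, hb⟩ := hi x (hn (hp hx).1).2
  obtain ⟨_, c, e'⟩ := hl _ hb
  refine e'.trans ?_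
  change g'.toFun _ = g'.toFun _
  congr 1
  exact Subtype.ext e

end PartialMap

/-- Morphisms are germs of continuous partial maps. -/
noncomputable instance : Category FilterSet.{u} where
  Hom X Y := Quotient (PartialMap.setoid X Y)
  id X := Quotient.mk _ (PartialMap.id X)
  comp f g := Quotient.map₂ PartialMap.comp
    (fun _ _ hf _ _ hg => PartialMap.comp_congr hf hg) f g
  id_comp f := by
    induction f using Quotient.inductionOn with
    | _ f =>
      refine Quotient.sound ?_
      obtain ⟨n, hn⟩ := FilterSet.directed _ ((PartialMap.id _).comp f).dom f.dom
      exact ⟨n, fun x hx => ⟨(hn hx).1, (hn hx).2, rfl⟩⟩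
  comp_id f := by
    induction f using Quotient.inductionOn with
    | _ f =>
      refine Quotient.sound ?_
      obtain ⟨n, hn⟩ := FilterSet.directed _ (f.comp (PartialMap.id _)).dom f.dom
      exact ⟨n, fun x hx => ⟨(hn hx).1, (hn hx).2, rfl⟩⟩
  assoc f g h := by
    induction f using Quotient.inductionOn with
    | _ f =>
    induction g using Quotient.inductionOn with
    | _ g =>
    induction h using Quotient.inductionOn with
    | _ h =>
      refine Quotient.sound ?_
      obtain ⟨n, hn⟩ := FilterSet.directed _ ((f.comp g).comp h).dom (f.comp (g.comp h)).dom
      exact ⟨n, fun x hx => ⟨(hn hx).1, (hn hx).2, rfl⟩⟩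

/-- The germ of a continuous partial map. -/
def PartialMap.germ {X Y : FilterSet.{u}} (f : PartialMap X Y) : X ⟶ Y :=
  Quotient.mk (PartialMap.setoid X Y) f

theorem exists_germ {X Y : FilterSet.{u}} (f : X ⟶ Y) : ∃ a : PartialMap X Y, a.germ = f :=
  Quotient.exists_rep f

theorem germ_eq_iff {X Y : FilterSet.{u}} {f g : PartialMap X Y} :
    f.germ = g.germ ↔ f.Equiv g :=
  Quotient.eq (r := PartialMap.setoid X Y)

theorem germ_comp {X Y Z : FilterSet.{u}} (f : PartialMap X Y) (g : PartialMap Y Z) :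
    f.germ ≫ g.germ = (f.comp g).germ := rfl

/-- The simple filter on a set `S`, with base `{S}`. -/
def simple (S : Type u) : FilterSet.{u} where
  carrier := S
  Idx := PUnit
  inhabited := ⟨PUnit.unit⟩
  base _ := Set.univ
  directed _ _ := ⟨PUnit.unit, by simp⟩

/-- The embedding of sets into filters, on maps. -/
def simpleMap {S T : Type u} (f : S → T) : simple S ⟶ simple T :=
  PartialMap.germ
    { dom := PUnit.unit
      toFun := fun x => f x.1
      continuous := fun _ => ⟨PUnit.unit, fun _ _ => ⟨trivial, trivial⟩⟩ }

/-- `simple 1` is terminal. -/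
noncomputable def simplePUnitIsTerminal : IsTerminal (simple PUnit.{u + 1}) :=
  IsTerminal.ofUniqueHom
    (fun X => Quotient.mk _
      { dom := Classical.choice X.inhabited
        toFun := fun _ => PUnit.unit
        continuous := fun _ => ⟨_, fun _ hx => ⟨hx, trivial⟩⟩ })
    (fun X f => by
      obtain ⟨a, rfl⟩ := exists_germ f
      refine germ_eq_iff.2 ?_
      obtain ⟨n, hn⟩ := X.directed a.dom (Classical.choice X.inhabited)
      exact ⟨n, fun x hx => ⟨(hn hx).1, (hn hx).2, rfl⟩⟩)

/-! ### Covering families and the topologies `K` and `K₁` -/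

/-- The image `f (X_i)` in `Y` of the base set `X_i` under a continuous partial map (the map is
applied to those elements of `X_i` at which it is defined). -/
def PartialMap.image {X Y : FilterSet.{u}} (f : PartialMap X Y) (i : X.Idx) : Set Y.carrier :=
  {y | ∃ (x : X.carrier) (_ : x ∈ X.base i) (h : x ∈ X.base f.dom), f.toFun ⟨x, h⟩ = y}

/-- A family `β k : G k ⟶ X` is jointly covering if, for all choices of base objects of the `G k`,
the union of their images contains a base object of `X`. Germs are handled by asking this for all
representatives (equivalently, for one choice of representatives). -/
def JointlyCovers {ι : Type} {X : FilterSet.{u}} (G : ι → FilterSet.{u}) (β : ∀ k, G k ⟶ X) :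
    Prop :=
  ∀ b : ∀ k, PartialMap (G k) X, (∀ k, (b k).germ = β k) →
    ∀ j : ∀ k, (G k).Idx, ∃ i : X.Idx, X.base i ⊆ ⋃ k, (b k).image (j k)

/-- Joint covering may be tested on one family of representatives, against arbitrary subsets. -/
theorem jointlyCovers_germ_iff {ι : Type} {X : FilterSet.{u}} {G : ι → FilterSet.{u}}
    (b : ∀ k, PartialMap (G k) X) :
    JointlyCovers G (fun k => (b k).germ) ↔
      ∀ j : ∀ k, (G k).Idx, ∃ i : X.Idx, X.base i ⊆ ⋃ k, (b k).image (j k) := by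
  refine ⟨fun h => h b fun _ => rfl, fun h b' hb' j => ?_⟩
  choose n hn using fun k => germ_eq_iff.1 (hb' k)
  choose p hp using fun k => (G k).directed (j k) (n k)
  obtain ⟨i, hi⟩ := h p
  refine ⟨i, hi.trans (Set.iUnion_mono fun k => ?_)⟩
  rintro y ⟨x, hx, hx', rfl⟩
  obtain ⟨h₁, h₂, e⟩ := hn k x (hp k hx).2
  exact ⟨x, (hp k hx).1, h₁, e⟩

/-- The fibre product over `Z` of two continuous partial maps, as a filter on the product of the
underlying sets. -/
def fibre {X Y Z : FilterSet.{u}} (a : PartialMap X Z) (b : PartialMap Y Z) : FilterSet.{u} where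
  carrier := X.carrier × Y.carrier
  Idx := X.Idx × Y.Idx
  inhabited := ⟨(a.dom, b.dom)⟩
  base p := {z | z.1 ∈ X.base p.1 ∧ z.2 ∈ Y.base p.2 ∧
    ∃ (h₁ : z.1 ∈ X.base a.dom) (h₂ : z.2 ∈ Y.base b.dom), a.toFun ⟨z.1, h₁⟩ = b.toFun ⟨z.2, h₂⟩}
  directed p q := by
    obtain ⟨i, hi⟩ := X.directed p.1 q.1
    obtain ⟨j, hj⟩ := Y.directed p.2 q.2
    exact ⟨(i, j), fun z hz => ⟨⟨(hi hz.1).1, (hj hz.2.1).1, hz.2.2⟩,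
      ⟨(hi hz.1).2, (hj hz.2.1).2, hz.2.2⟩⟩⟩

/-- First projection of the fibre product. -/
def fibreFst {X Y Z : FilterSet.{u}} (a : PartialMap X Z) (b : PartialMap Y Z) :
    PartialMap (fibre a b) X where
  dom := (a.dom, b.dom)
  toFun z := z.1.1
  continuous j := by
    obtain ⟨k, hk⟩ := X.directed a.dom j
    exact ⟨(k, b.dom), fun z hz => ⟨⟨(hk hz.1).1, hz.2.1, hz.2.2⟩, (hk hz.1).2⟩⟩

/-- Second projection of the fibre product. -/
def fibreSnd {X Y Z : FilterSet.{u}} (a : PartialMap X Z) (b : PartialMap Y Z) :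
    PartialMap (fibre a b) Y where
  dom := (a.dom, b.dom)
  toFun z := z.1.2
  continuous j := by
    obtain ⟨k, hk⟩ := Y.directed b.dom j
    exact ⟨(a.dom, k), fun z hz => ⟨⟨hz.1, (hk hz.2.1).1, hz.2.2⟩, (hk hz.2.1).2⟩⟩

theorem fibre_condition {X Y Z : FilterSet.{u}} (a : PartialMap X Z) (b : PartialMap Y Z) :
    (fibreFst a b).germ ≫ a.germ = (fibreSnd a b).germ ≫ b.germ := by
  rw [germ_comp, germ_comp, germ_eq_iff]
  obtain ⟨n, hn⟩ := (fibre a b).directed ((fibreFst a b).comp a).dom ((fibreSnd a b).comp b).dom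
  refine ⟨n, fun z hz => ⟨(hn hz).1, (hn hz).2, ?_⟩⟩
  obtain ⟨h₁, h₂, e⟩ := hz.2.2
  exact e

theorem jointlyCovers_id (X : FilterSet.{u}) :
    JointlyCovers (fun _ : Unit => X) (fun _ => 𝟙 X) := by
  refine (jointlyCovers_germ_iff (fun _ : Unit => PartialMap.id X)).2 fun j => ?_
  obtain ⟨n, hn⟩ := X.directed (j ()) X.inhabited.some
  exact ⟨n, fun x hx => Set.mem_iUnion.2 ⟨(), x, (hn hx).1, (hn hx).2, rfl⟩⟩

theorem exists_base_subset_iInter {ι : Type} [Finite ι] (X : FilterSet.{u}) (i : ι → X.Idx) :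
    ∃ n, ∀ k, X.base n ⊆ X.base (i k) := by
  classical
  cases nonempty_fintype ι
  have : ∀ s : Finset ι, ∃ n, ∀ k ∈ s, X.base n ⊆ X.base (i k) := by
    intro s
    induction s using Finset.induction_on with
    | empty => exact ⟨X.inhabited.some, by simp⟩
    | insert a s _ ih =>
      obtain ⟨n, hn⟩ := ih
      obtain ⟨p, hp⟩ := X.directed n (i a)
      refine ⟨p, fun k hk => ?_⟩
      rcases Finset.mem_insert.1 hk with rfl | hk
      · exact fun x hx => (hp hx).2
      · exact fun x hx => hn k hk (hp hx).1
  obtain ⟨n, hn⟩ := this Finset.univ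
  exact ⟨n, fun k => hn k (Finset.mem_univ k)⟩

theorem JointlyCovers.pullback {ι : Type} [Finite ι] {X Y : FilterSet.{u}}
    {G : ι → FilterSet.{u}} (b : ∀ k, PartialMap (G k) X)
    (h : JointlyCovers G fun k => (b k).germ) (a : PartialMap Y X) :
    JointlyCovers (fun k => fibre a (b k)) (fun k => (fibreFst a (b k)).germ) := by
  rw [jointlyCovers_germ_iff] at h ⊢
  intro j
  obtain ⟨n, hn⟩ := exists_base_subset_iInter Y fun k => (j k).1
  obtain ⟨l, hl⟩ := h fun k => (j k).2
  obtain ⟨m, hm⟩ := a.continuous l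
  obtain ⟨p, hp⟩ := Y.directed n m
  refine ⟨p, fun y hy => ?_⟩
  obtain ⟨hy', hy''⟩ := hm y (hp hy).2
  obtain ⟨k, x, hx, hx', e⟩ := Set.mem_iUnion.1 (hl hy'')
  refine Set.mem_iUnion.2 ⟨k, (y, x), ⟨hn k (hp hy).1, hx, hy', hx', e.symm⟩,
    ⟨hy', hx', hy', hx', e.symm⟩, rfl⟩

theorem JointlyCovers.bind {ι : Type} {κ : ι → Type} {X : FilterSet.{u}}
    {G : ι → FilterSet.{u}} {β : ∀ k, G k ⟶ X} (h : JointlyCovers G β)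
    {H : ∀ k, κ k → FilterSet.{u}} {γ : ∀ k l, H k l ⟶ G k}
    (h' : ∀ k, JointlyCovers (H k) (γ k)) :
    JointlyCovers (fun p : Σ k, κ k => H p.1 p.2) (fun p => γ p.1 p.2 ≫ β p.1) := by
  choose b hb using fun k => exists_germ (β k)
  choose c hc using fun k l => exists_germ (γ k l)
  obtain rfl : (fun k => (b k).germ) = β := funext hb
  obtain rfl : (fun k l => (c k l).germ) = γ := funext fun k => funext (hc k)
  simp only [germ_comp]
  refine (jointlyCovers_germ_iff (fun p : Σ k, κ k => (c p.1 p.2).comp (b p.1))).2 fun j => ?_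
  choose q hq using fun k l =>
    (H k l).directed (j ⟨k, l⟩) ((c k l).comp (b k)).dom
  choose r hr using fun k => (jointlyCovers_germ_iff (c k)).1 (h' k) (q k)
  obtain ⟨i, hi⟩ := (jointlyCovers_germ_iff b).1 h r
  refine ⟨i, fun x hx => ?_⟩
  obtain ⟨k, y, hy, hy', rfl⟩ := Set.mem_iUnion.1 (hi hx)
  obtain ⟨l, z, hz, hz', rfl⟩ := Set.mem_iUnion.1 (hr k hy)
  exact Set.mem_iUnion.2 ⟨⟨k, l⟩, z, (hq k l hz).1, (hq k l hz).2, rfl⟩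

/-- The Grothendieck topology whose covering sieves are those which contain a jointly covering
family, indexed by a type in a class `P` of finite types. -/
def coverTopology (P : Type → Prop) (hfin : ∀ ι, P ι → Finite ι) (hunit : P Unit)
    (hsigma : ∀ (ι : Type) (κ : ι → Type), P ι → (∀ k, P (κ k)) → P (Σ k, κ k)) :
    GrothendieckTopology FilterSet.{u} where
  sieves X := {S | ∃ (ι : Type) (_ : P ι) (G : ι → FilterSet.{u}) (β : ∀ k, G k ⟶ X),
    JointlyCovers G β ∧ ∀ k, S (β k)}
  top_mem' X := ⟨Unit, hunit, fun _ => X, fun _ => 𝟙 X, jointlyCovers_id X, fun _ => trivial⟩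
  pullback_stable' := by
    rintro X Y S f ⟨ι, hι, G, β, h, hS⟩
    have := hfin ι hι
    choose b hb using fun k => exists_germ (β k)
    obtain rfl : (fun k => (b k).germ) = β := funext hb
    obtain ⟨a, rfl⟩ := exists_germ f
    refine ⟨ι, hι, _, _, JointlyCovers.pullback b h a, fun k => ?_⟩
    change S ((fibreFst a (b k)).germ ≫ a.germ)
    rw [fibre_condition]
    exact S.downward_closed (hS k) _
  transitive' := by
    rintro X S ⟨ι, hι, G, β, h, hS⟩ R hR
    choose κ hκ H γ h' hR' using fun k => hR (hS k)
    exact ⟨Σ k, κ k, hsigma ι κ hι hκ, _, _, h.bind h', fun p => hR' p.1 p.2⟩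

/-- The topology `K`: covers are finite jointly covering families. -/
def K : GrothendieckTopology FilterSet.{u} :=
  coverTopology (fun ι => Finite ι) (fun _ h => h) inferInstance
    (fun _ _ _ _ => inferInstance)

/-- The topology `K₁`: covers are single covering morphisms, together with the empty cover of the
initial object; i.e. jointly covering families with at most one member. (The empty family is
jointly covering precisely for the non-proper filters, which are the initial objects.) -/
def K₁ : GrothendieckTopology FilterSet.{u} :=
  coverTopology (fun ι => Subsingleton ι) (fun _ _ => inferInstance) inferInstance
    (fun _ _ h h' => ⟨fun ⟨a, b⟩ ⟨a', b'⟩ => by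
      obtain rfl := h.elim a a'
      obtain rfl := (h' a).elim b b'
      rfl⟩)

theorem mem_K_iff {X : FilterSet.{u}} (S : Sieve X) :
    S ∈ K X ↔ ∃ (ι : Type) (_ : Finite ι) (G : ι → FilterSet.{u}) (β : ∀ k, G k ⟶ X),
      JointlyCovers G β ∧ ∀ k, S (β k) := Iff.rfl

theorem mem_K₁_iff {X : FilterSet.{u}} (S : Sieve X) :
    S ∈ K₁ X ↔ (∃ (G : FilterSet.{u}) (β : G ⟶ X),
      JointlyCovers (fun _ : Unit => G) (fun _ => β) ∧ S β) ∨ ∃ i, X.base i = ∅ := by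
  constructor
  · rintro ⟨ι, hι, G, β, h, hS⟩
    rcases isEmpty_or_nonempty ι with he | ⟨⟨k⟩⟩
    · right
      choose b hb using fun k => exists_germ (β k)
      obtain ⟨i, hi⟩ := h b hb fun k => he.elim k
      exact ⟨i, Set.subset_empty_iff.1 (by simpa using hi)⟩
    · left
      refine ⟨G k, β k, fun b hb j => ?_, hS k⟩
      have e : ∀ k', k' = k := fun k' => Subsingleton.elim _ _
      obtain ⟨i, hi⟩ := h (fun k' => (e k') ▸ b ()) (fun k' => by
        obtain rfl := e k'
        exact hb ()) (fun k' => (e k') ▸ j ())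
      refine ⟨i, fun x hx => ?_⟩
      obtain ⟨k', hk'⟩ := Set.mem_iUnion.1 (hi hx)
      obtain rfl := e k'
      exact Set.mem_iUnion.2 ⟨(), hk'⟩
  · rintro (⟨G, β, h, hS⟩ | ⟨i, hi⟩)
    · exact ⟨Unit, inferInstance, _, _, h, fun _ => hS⟩
    · exact ⟨Empty, inferInstance, fun k => k.elim, fun k => k.elim,
        fun _ _ _ => ⟨i, by simp [hi]⟩, fun k => k.elim⟩

theorem K₁_le_K : K₁.{u} ≤ K.{u} := by
  rintro X S ⟨ι, hι, G, β, h, hS⟩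
  exact ⟨ι, inferInstance, G, β, h, hS⟩

/-! ### `K₁` is subcanonical -/

theorem cancel_of_covers {X Y Z : FilterSet.{u}} (f : X ⟶ Y)
    (h : JointlyCovers (fun _ : Unit => X) (fun _ => f)) {g g' : Y ⟶ Z} (e : f ≫ g = f ≫ g') :
    g = g' := by
  obtain ⟨a, rfl⟩ := exists_germ f
  obtain ⟨b, rfl⟩ := exists_germ g
  obtain ⟨b', rfl⟩ := exists_germ g'
  rw [germ_comp, germ_comp, germ_eq_iff] at e
  obtain ⟨k, hk⟩ := e
  obtain ⟨i, hi⟩ := (jointlyCovers_germ_iff (fun _ : Unit => a)).1 h fun _ => k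
  obtain ⟨n, hn⟩ := Y.directed b.dom b'.dom
  obtain ⟨p, hp⟩ := Y.directed i n
  refine germ_eq_iff.2 ⟨p, fun y hy => ⟨(hn (hp hy).2).1, (hn (hp hy).2).2, ?_⟩⟩
  obtain ⟨_, x, hx, hx', rfl⟩ := Set.mem_iUnion.1 (hi (hp hy).1)
  exact (hk x hx).2.2

theorem exists_descent {X Y Z : FilterSet.{u}} (a : PartialMap X Y)
    (h : JointlyCovers (fun _ : Unit => X) (fun _ => a.germ)) (c : PartialMap X Z)
    (e : (fibreFst a a).germ ≫ c.germ = (fibreSnd a a).germ ≫ c.germ) :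
    ∃ t : Y ⟶ Z, a.germ ≫ t = c.germ := by
  have h := fun j => (jointlyCovers_germ_iff (fun _ : Unit => a)).1 h fun _ => j
  rw [germ_comp, germ_comp, germ_eq_iff] at e
  obtain ⟨k, hk⟩ := e
  obtain ⟨q, hq⟩ := X.directed k.1 k.2
  obtain ⟨n, hn⟩ := X.directed q c.dom
  have key : ∀ x (_ : x ∈ X.base n) (hx : x ∈ X.base a.dom) (hc : x ∈ X.base c.dom)
      x' (_ : x' ∈ X.base n) (hx' : x' ∈ X.base a.dom) (hc' : x' ∈ X.base c.dom),
      a.toFun ⟨x, hx⟩ = a.toFun ⟨x', hx'⟩ → c.toFun ⟨x, hc⟩ = c.toFun ⟨x', hc'⟩ := by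
    intro x h₁ hx hc x' h₂ hx' hc' he
    exact (hk (x, x') ⟨(hq (hn h₁).1).1, (hq (hn h₂).1).2, hx, hx', he⟩).2.2
  obtain ⟨i, hi⟩ := h n
  have hsec : ∀ y : Y.base i, ∃ x, x ∈ X.base n ∧ ∃ hx : x ∈ X.base a.dom,
      a.toFun ⟨x, hx⟩ = y.1 := by
    intro y
    obtain ⟨_, x, hx, hx', e⟩ := Set.mem_iUnion.1 (hi y.2)
    exact ⟨x, hx, hx', e⟩
  choose s hs hs' hs'' using hsec
  let t : PartialMap Y Z :=
    { dom := i
      toFun := fun y => c.toFun ⟨s y, (hn (hs y)).2⟩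
      continuous := fun j => by
        obtain ⟨l, hl⟩ := c.continuous j
        obtain ⟨p, hp⟩ := X.directed n l
        obtain ⟨r, hr⟩ := h p
        obtain ⟨w, hw⟩ := Y.directed i r
        refine ⟨w, fun y hy => ⟨(hw hy).1, ?_⟩⟩
        obtain ⟨_, x, hx, hx', e⟩ := Set.mem_iUnion.1 (hr (hw hy).2)
        obtain ⟨hc, hj⟩ := hl x (hp hx).2
        have := key x (hp hx).1 hx' hc _ (hs ⟨y, (hw hy).1⟩) (hs' ⟨y, (hw hy).1⟩)
          (hn (hs ⟨y, (hw hy).1⟩)).2 (e.trans (hs'' ⟨y, (hw hy).1⟩).symm)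
        exact this ▸ hj }
  refine ⟨t.germ, ?_⟩
  rw [germ_comp, germ_eq_iff]
  obtain ⟨p, hp⟩ := X.directed n (a.comp t).dom
  refine ⟨p, fun x hx => ⟨(hp hx).2, (hn (hp hx).1).2, ?_⟩⟩
  have hxa : x ∈ X.base a.dom := ((a.continuous i).choose_spec x (hp hx).2).choose
  refine (key _ (hs _) (hs' _) (hn (hs _)).2 x (hp hx).1 hxa _ (hs'' _))

theorem existsUnique_hom_of_base_eq_empty {X : FilterSet.{u}} {i : X.Idx} (hi : X.base i = ∅)
    (Y : FilterSet.{u}) : ∃! _ : X ⟶ Y, True := by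
  refine ⟨PartialMap.germ ⟨i, fun x => ((hi ▸ x.2 : x.1 ∈ (∅ : Set _))).elim,
    fun _ => ⟨i, fun x hx => ((hi ▸ hx : x ∈ (∅ : Set _))).elim⟩⟩, trivial, fun f _ => ?_⟩
  obtain ⟨a, rfl⟩ := exists_germ f
  exact germ_eq_iff.2 ⟨i, fun x hx => ((hi ▸ hx : x ∈ (∅ : Set _))).elim⟩

instance : K₁.{u}.Subcanonical := by
  refine GrothendieckTopology.Subcanonical.of_isSheaf_yoneda_obj _ fun Z X S hS x hx => ?_
  rcases (mem_K₁_iff S).1 hS with ⟨G, β, hβ, hSβ⟩ | ⟨i, hi⟩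
  · obtain ⟨b, rfl⟩ := exists_germ β
    obtain ⟨c, hc⟩ := exists_germ (X := G) (Y := Z) (x b.germ hSβ)
    obtain ⟨t, ht⟩ := exists_descent b hβ c (by
      rw [hc]
      exact hx _ _ hSβ hSβ (fibre_condition b b))
    refine ⟨t, fun Y f hf => ?_, fun t' ht' => ?_⟩
    · obtain ⟨a, rfl⟩ := exists_germ f
      refine cancel_of_covers (fibreFst a b).germ
        (JointlyCovers.pullback (fun _ : Unit => b) hβ a) ?_
      have h₁ : (fibreFst a b).germ ≫ x a.germ hf = (fibreSnd a b).germ ≫ x b.germ hSβ :=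
        hx _ _ hf hSβ (fibre_condition a b)
      change (fibreFst a b).germ ≫ a.germ ≫ t = _
      rw [h₁, ← hc, ← ht, ← Category.assoc, ← Category.assoc, fibre_condition]
    · refine cancel_of_covers b.germ hβ ?_
      rw [ht, hc]
      exact ht' _ hSβ
  · obtain ⟨t, -, ht⟩ := existsUnique_hom_of_base_eq_empty hi Z
    refine ⟨t, fun Y f hf => ?_, fun t' _ => ht t' trivial⟩
    obtain ⟨a, rfl⟩ := exists_germ f
    obtain ⟨k, hk⟩ := a.continuous i
    have hk' : Y.base k = ∅ := Set.eq_empty_of_forall_notMem fun y hy => by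
      obtain ⟨_, h⟩ := hk y hy
      exact (hi ▸ h : _ ∈ (∅ : Set _))
    exact (existsUnique_hom_of_base_eq_empty hk' Z).unique trivial trivial

end FilterSet

/-! ### Local operators on an elementary topos -/

section LocalOperator

variable {E : Type v} [Category.{w} E] [HasBinaryProducts E] (c : Subobject.Classifier E)

/-- The meet `Ω × Ω ⟶ Ω` of truth values: the characteristic map of `⟨true, true⟩`. -/
noncomputable def Omega.and : c.Ω ⨯ c.Ω ⟶ c.Ω :=
  c.χ (prod.lift c.truth c.truth)

/-- A local operator (Lawvere–Tierney topology). -/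
structure LocalOperator where
  hom : c.Ω ⟶ c.Ω
  truth_hom : c.truth ≫ hom = c.truth
  hom_hom : hom ≫ hom = hom
  and_hom : Omega.and c ≫ hom = prod.map hom hom ≫ Omega.and c

namespace LocalOperator

variable {c}

/-- The order of local operators is the order of morphisms into the internal meet-semilattice `Ω`:
`j ≤ j'` iff `j ∧ j' = j`. -/
instance : LE (LocalOperator c) where
  le j j' := prod.lift j.hom j'.hom ≫ Omega.and c = j.hom

/-- A monomorphism `m : A ⟶ X` is `j`-dense if its `j`-closure, the subobject of `X` with
characteristic map `χ m ≫ j`, is all of `X`. -/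
def IsDense (j : LocalOperator c) {A X : E} (m : A ⟶ X) [Mono m] : Prop :=
  c.χ m ≫ j.hom = c.χ (𝟙 X)

/-- `F` is a `j`-sheaf if morphisms into `F` extend uniquely along `j`-dense monomorphisms. -/
def isSheaf (j : LocalOperator c) : ObjectProperty E := fun F =>
  ∀ ⦃A X : E⦄ (m : A ⟶ X) [Mono m], j.IsDense m → ∀ f : A ⟶ F, ∃! g : X ⟶ F, m ≫ g = f

/-- The full subcategory `sh_j(E)` of `j`-sheaves. -/
abbrev Sh (j : LocalOperator c) := j.isSheaf.FullSubcategory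

end LocalOperator

end LocalOperator

/-! ### The topoi `𝒰` and `𝒩` -/

namespace FilterSet

/-- The topos `𝒩` of `K`-sheaves. Filters are filters on sets in a universe `u`; they form a small
site relative to the next universe, in which the sheaves take their values. -/
abbrev ToposN := Sheaf K.{u} (Type (u + 1))

/-- The topos `𝒰` of `K₁`-sheaves. -/
abbrev ToposU := Sheaf K₁.{u} (Type (u + 1))

instance : HasSheafify K₁.{u} (Type (u + 1)) :=
  inferInstanceAs (HasSheafify K₁.{u} (Type (max u (u + 1))))

instance : HasTerminal ToposU.{u} := inferInstance

instance : HasBinaryCoproducts ToposU.{u} :=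
  have : HasFiniteColimits ToposU.{u} := inferInstance
  hasColimitsOfShape_of_hasFiniteColimits ToposU.{u} (Discrete WalkingPair)

/-- The inclusion of `𝒩` in `𝒰`. -/
noncomputable def inclusionNU : ToposN.{u} ⥤ ToposU.{u} :=
  ObjectProperty.ιOfLE fun F hF => by
    rw [isSheaf_iff_isSheaf_of_type] at hF ⊢
    exact Presieve.isSheaf_of_le F K₁_le_K hF

/-- The subobject classifier of `𝒰` (the sheaf of closed sieves). -/
noncomputable abbrev classifierU : Subobject.Classifier ToposU.{u} := Sheaf.classifier K₁.{u}

/-- The Yoneda embedding into `𝒰`. -/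
noncomputable abbrev yU : FilterSet.{u} ⥤ ToposU.{u} := GrothendieckTopology.uliftYoneda.{u + 1} K₁

/-- `y 1` is terminal in `𝒰`. -/
noncomputable def yOneIsTerminal : IsTerminal (yU.{u}.obj (simple PUnit)) :=
  IsTerminal.ofUniqueHom
    (fun F => ⟨{ app := fun X => TypeCat.ofHom fun _ => ULift.up (simplePUnitIsTerminal.from X.unop)
                 naturality := fun X Y f => by
                   ext x
                   exact ULift.ext _ _ (simplePUnitIsTerminal.hom_ext _ _) }⟩)
    (fun F f => by
      ext X x
      exact ULift.ext _ _ (simplePUnitIsTerminal.hom_ext _ _))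

/-- The global element of `y 2` given by an element of `2`. -/
noncomputable def yPoint (b : ULift.{u} Bool) : ⊤_ ToposU.{u} ⟶ yU.obj (simple (ULift.{u} Bool)) :=
  yOneIsTerminal.from _ ≫ yU.map (simpleMap fun _ => b)

/-- The canonical morphism `m : 2 = 1 + 1 ⟶ y 2` in `𝒰`. -/
noncomputable def twoToYTwo :
    (⊤_ ToposU.{u}) ⨿ (⊤_ ToposU.{u}) ⟶ yU.obj (simple (ULift.{u} Bool)) :=
  coprod.desc (yPoint ⟨false⟩) (yPoint ⟨true⟩)

end FilterSet

/-! Sections of `Ω` over a site `(C, J)` are `J`-closed sieves, so a local operator `j` is a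
pullback-stable closure operator on sieves and yields a Grothendieck topology `j.topology`
containing `J`. Conversely, `ofTopology` turns any finer topology into a local operator with that
topology (`topology_ofTopology`). The order is preserved and reflected (`le_iff_topology_le`), and
over a subcanonical site the `j`-sheaves are exactly the sheaves for `j.topology` (`isSheaf_iff`).

It remains to show that `m` is `j`-dense iff `K ≤ j.topology` (`isDense_twoToYTwo_iff`); the least
such operator then has topology `K`. The image of `m` is the subsheaf of constant maps to `2`, so
density says that the sieve of constant maps covers the filter `2`. Pulled back along an indicator
function, this sieve splits a filter into a subset and its complement (`K_le_of_constSieve_mem`).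
Such splittings and `K₁` generate `K` (`K_le_of_split`): a finite jointly covering family is a
single cover by the sum of its members, followed by splitting the sum into its summands. -/

namespace LocalOperator

variable {C : Type u} [Category.{v} C] {J : GrothendieckTopology C}

/-! ### Sections of products and of the subobject classifier -/

/-- Sections of a product of sheaves are determined by their components. -/
theorem prod_section_ext {A B : Sheaf J (Type (max u v))} {X : Cᵒᵖ} {p q : (A ⨯ B).obj.obj X}
    (h₁ : (prod.fst : A ⨯ B ⟶ A).hom.app X p = (prod.fst : A ⨯ B ⟶ A).hom.app X q)
    (h₂ : (prod.snd : A ⨯ B ⟶ B).hom.app X p = (prod.snd : A ⨯ B ⟶ B).hom.app X q) : p = q := by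
  -- Taking sections over `X` preserves limits; an element is then a map from `PUnit` into a product
  -- of types.
  let G := sheafToPresheaf J (Type (max u v)) ⋙ (evaluation _ _).obj X
  have hl := mapIsLimitOfPreservesOfIsLimit G _ _ (prodIsProd A B)
  have : (↾fun _ : PUnit.{max u v + 1} => p) = ↾fun _ : PUnit.{max u v + 1} => q :=
    BinaryFan.IsLimit.hom_ext hl (by ext; exact h₁) (by ext; exact h₂)
  exact ConcreteCategory.congr_hom this PUnit.unit

theorem exists_prod_section {A B : Sheaf J (Type (max u v))} {X : Cᵒᵖ} (a : A.obj.obj X)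
    (b : B.obj.obj X) : ∃ p : (A ⨯ B).obj.obj X, (prod.fst : A ⨯ B ⟶ A).hom.app X p = a ∧
      (prod.snd : A ⨯ B ⟶ B).hom.app X p = b := by
  let G := sheafToPresheaf J (Type (max u v)) ⋙ (evaluation _ _).obj X
  have hl := mapIsLimitOfPreservesOfIsLimit G _ _ (prodIsProd A B)
  obtain ⟨l, h₁, h₂⟩ := BinaryFan.IsLimit.lift' hl (↾fun _ : PUnit.{max u v + 1} => a)
    (↾fun _ : PUnit.{max u v + 1} => b)
  exact ⟨l PUnit.unit, ConcreteCategory.congr_hom h₁ PUnit.unit,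
    ConcreteCategory.congr_hom h₂ PUnit.unit⟩

/-- The closed sieve underlying a section of the subobject classifier. -/
abbrev sieve {X : Cᵒᵖ} (x : (Sheaf.classifier J).Ω.obj.obj X) : Sieve X.unop := x.1

theorem sieve_isClosed {X : Cᵒᵖ} (x : (Sheaf.classifier J).Ω.obj.obj X) :
    J.IsClosed (sieve x) := x.2

theorem sieve_ext {X : Cᵒᵖ} {x y : (Sheaf.classifier J).Ω.obj.obj X} (h : sieve x = sieve y) :
    x = y := Subtype.ext h

theorem sieve_map {X Y : Cᵒᵖ} (f : X ⟶ Y) (x : (Sheaf.classifier J).Ω.obj.obj X) :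
    sieve ((Sheaf.classifier J).Ω.obj.map f x) = (sieve x).pullback f.unop := rfl

/-- The section of the subobject classifier given by a closed sieve. -/
def closedSection (X : C) (S : Sieve X) (h : J.IsClosed S) :
    (Sheaf.classifier J).Ω.obj.obj (op X) := ⟨S, h⟩

theorem hom_ext_sieve {A : Sheaf J (Type (max u v))} {f g : A ⟶ (Sheaf.classifier J).Ω}
    (h : ∀ (X : C) (x : A.obj.obj (op X)), sieve (f.hom.app (op X) x) = sieve (g.hom.app (op X) x)) :
    f = g := by
  ext X x
  exact sieve_ext (h X.unop x)

theorem sieve_χ_iff {A B : Sheaf J (Type (max u v))} (m : A ⟶ B) [Mono m] {X : Cᵒᵖ} {Y : C}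
    (x : B.obj.obj X) (f : Y ⟶ X.unop) :
    sieve (((Sheaf.classifier J).χ m).hom.app X x) f ↔
      ∃ a, m.hom.app (op Y) a = B.obj.map f.op x := by
  change (∃ a, _ = _) ↔ _
  simp only [eq_comm]

/-- The restriction of `p` along `f` is `⟨true, true⟩` iff both component sieves pull back to `⊤`
along `f`, i.e. iff both contain `f`. -/
theorem sieve_and {X : Cᵒᵖ}
    (p : ((Sheaf.classifier J).Ω ⨯ (Sheaf.classifier J).Ω).obj.obj X) :
    sieve ((Omega.and (Sheaf.classifier J)).hom.app X p) =
      sieve ((prod.fst : (Sheaf.classifier J).Ω ⨯ (Sheaf.classifier J).Ω ⟶ _).hom.app X p) ⊓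
      sieve ((prod.snd : (Sheaf.classifier J).Ω ⨯ (Sheaf.classifier J).Ω ⟶ _).hom.app X p) := by
  ext Y f
  rw [Omega.and, sieve_χ_iff, Sieve.inter_apply, Sieve.mem_iff_pullback_eq_top,
    Sieve.mem_iff_pullback_eq_top]
  have h₁ := fun a => congr(($(prod.lift_fst (Sheaf.classifier J).truth
    (Sheaf.classifier J).truth)).hom.app (op Y) a)
  have h₂ := fun a => congr(($(prod.lift_snd (Sheaf.classifier J).truth
    (Sheaf.classifier J).truth)).hom.app (op Y) a)
  have n₁ := NatTrans.naturality_apply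
    (prod.fst : (Sheaf.classifier J).Ω ⨯ (Sheaf.classifier J).Ω ⟶ _).hom f.op p
  have n₂ := NatTrans.naturality_apply
    (prod.snd : (Sheaf.classifier J).Ω ⨯ (Sheaf.classifier J).Ω ⟶ _).hom f.op p
  constructor
  · rintro ⟨a, ha⟩
    have e₁ := congrArg sieve ((congrArg (fun z => (prod.fst :
      (Sheaf.classifier J).Ω ⨯ (Sheaf.classifier J).Ω ⟶ _).hom.app (op Y) z) ha).symm.trans (h₁ a))
    have e₂ := congrArg sieve ((congrArg (fun z => (prod.snd :
      (Sheaf.classifier J).Ω ⨯ (Sheaf.classifier J).Ω ⟶ _).hom.app (op Y) z) ha).symm.trans (h₂ a))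
    exact ⟨(congrArg sieve n₁).symm.trans e₁, (congrArg sieve n₂).symm.trans e₂⟩
  · rintro ⟨e₁, e₂⟩
    refine ⟨PUnit.unit, prod_section_ext ?_ ?_⟩
    · rw [n₁]
      exact (h₁ PUnit.unit).trans (sieve_ext e₁.symm)
    · rw [n₂]
      exact (h₂ PUnit.unit).trans (sieve_ext e₂.symm)

theorem sieve_lift_and {A : Sheaf J (Type (max u v))} (f g : A ⟶ (Sheaf.classifier J).Ω) {X : Cᵒᵖ}
    (x : A.obj.obj X) :
    sieve ((prod.lift f g ≫ Omega.and (Sheaf.classifier J)).hom.app X x) =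
      sieve (f.hom.app X x) ⊓ sieve (g.hom.app X x) := by
  have h₁ := congr(($(prod.lift_fst f g)).hom.app X x)
  have h₂ := congr(($(prod.lift_snd f g)).hom.app X x)
  rw [← h₁, ← h₂]
  exact sieve_and _

/-! ### From local operators to Grothendieck topologies -/

variable (j : LocalOperator (Sheaf.classifier J))

/-- The action of a local operator on closed sieves, extended to all sieves. -/
noncomputable def closure (X : C) (S : Sieve X) : Sieve X :=
  sieve (j.hom.hom.app (op X) (closedSection X (J.close S) (J.close_isClosed S)))

theorem sieve_hom {X : Cᵒᵖ} (x : (Sheaf.classifier J).Ω.obj.obj X) :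
    sieve (j.hom.hom.app X x) = j.closure X.unop (sieve x) := by
  unfold closure
  congr 2
  exact sieve_ext (J.close_eq_self_of_isClosed (sieve_isClosed x)).symm

theorem sieve_comp_hom {A : Sheaf J (Type (max u v))} (f : A ⟶ (Sheaf.classifier J).Ω) {X : Cᵒᵖ}
    (x : A.obj.obj X) :
    sieve ((f ≫ j.hom).hom.app X x) = j.closure X.unop (sieve (f.hom.app X x)) :=
  sieve_hom j _

/-- This is naturality of `j.hom`, together with stability of `J.close` under pullback. -/
theorem closure_pullback {X Y : C} (f : Y ⟶ X) (S : Sieve X) :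
    j.closure Y (S.pullback f) = (j.closure X S).pullback f := by
  have := congrArg sieve (NatTrans.naturality_apply j.hom.hom f.op
    (closedSection X (J.close S) (J.close_isClosed S)))
  refine Eq.trans ?_ (this.trans (sieve_map _ _))
  unfold closure
  congr 2
  exact sieve_ext (J.pullback_close f S)

theorem closure_closure {X : C} (S : Sieve X) :
    j.closure X (j.closure X S) = j.closure X S := by
  have := congr(sieve (($(j.hom_hom)).hom.app (op X)
    (closedSection X (J.close S) (J.close_isClosed S))))
  exact (sieve_hom j _).symm.trans this

theorem closure_top (X : C) : j.closure X ⊤ = ⊤ := by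
  have := congr(sieve (($(j.truth_hom)).hom.app (op X) PUnit.unit))
  exact (sieve_hom j _).symm.trans this

/-- The axiom `and_hom` is evaluated at the section of `Ω ⨯ Ω` with components `S` and `T`. -/
theorem closure_inf {X : C} {S T : Sieve X} (hS : J.IsClosed S) (hT : J.IsClosed T) :
    j.closure X (S ⊓ T) = j.closure X S ⊓ j.closure X T := by
  obtain ⟨p, h₁, h₂⟩ := exists_prod_section (closedSection X S hS) (closedSection X T hT)
  have h := congr(sieve (($(j.and_hom)).hom.app (op X) p))
  have m₁ := congr(sieve (($(prod.map_fst j.hom j.hom)).hom.app (op X) p))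
  have m₂ := congr(sieve (($(prod.map_snd j.hom j.hom)).hom.app (op X) p))
  rw [sieve_comp_hom, sieve_and, h₁, h₂] at h
  refine h.trans ((sieve_and _).trans ?_)
  refine congrArg₂ _ (m₁.trans ?_) (m₂.trans ?_)
  · rw [sieve_comp_hom, h₁]
    rfl
  · rw [sieve_comp_hom, h₂]
    rfl

theorem closure_close {X : C} (S : Sieve X) : j.closure X (J.close S) = j.closure X S := by
  unfold closure
  congr 2
  exact sieve_ext (J.close_close S)

/-- After passing to `J`-closures, `S = S ⊓ T`, and preservation of meets gives monotonicity. -/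
theorem closure_mono {X : C} {S T : Sieve X} (h : S ≤ T) : j.closure X S ≤ j.closure X T := by
  rw [← closure_close, ← closure_close j T,
    ← inf_eq_left.2 (J.monotone_close h), closure_inf j (J.close_isClosed S) (J.close_isClosed T)]
  exact inf_le_right

theorem le_closure {X : C} (S : Sieve X) : S ≤ j.closure X S := by
  intro Y f hf
  rw [Sieve.mem_iff_pullback_eq_top, ← closure_pullback, Sieve.pullback_eq_top_of_mem S hf,
    closure_top]

/-- The Grothendieck topology corresponding to a local operator on a category of sheaves. -/
noncomputable def topology : GrothendieckTopology C :=
  topologyOfClosureOperator (fun X => ClosureOperator.mk' (j.closure X) (fun _ _ => j.closure_mono)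
    j.le_closure fun S => (j.closure_closure S).le) fun _ _ => j.closure_pullback

theorem mem_topology_iff {X : C} (S : Sieve X) : S ∈ j.topology X ↔ j.closure X S = ⊤ := Iff.rfl

theorem topology_close {X : C} (S : Sieve X) : j.topology.close S = j.closure X S :=
  topologyOfClosureOperator_close _ _ X S

theorem le_topology : J ≤ j.topology := by
  intro X S hS
  rw [mem_topology_iff, ← closure_close, (J.close_eq_top_iff_mem S).2 hS, closure_top]

/-- A local operator is recovered from its topology, because its closure is `j.topology.close`.
Comparing operators, closures, or covering sieves (those with closure `⊤`) therefore amounts to the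
same. -/
theorem le_iff_topology_le {j j' : LocalOperator (Sheaf.classifier J)} :
    j ≤ j' ↔ j.topology ≤ j'.topology := by
  have key : j ≤ j' ↔ ∀ (X : C) (S : Sieve X), j.closure X S ≤ j'.closure X S := by
    constructor
    · intro h X S
      have := congr(sieve (($(show prod.lift j.hom j'.hom ≫ Omega.and _ = j.hom from h)).hom.app
        (op X) (closedSection X (J.close S) (J.close_isClosed S))))
      rw [sieve_lift_and] at this
      exact inf_eq_left.1 this
    · intro h
      refine hom_ext_sieve fun X x => ?_
      rw [sieve_lift_and, sieve_hom, sieve_hom, inf_eq_left]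
      exact h _ _
  rw [key]
  constructor
  · intro h X S hS
    rw [mem_topology_iff] at hS ⊢
    exact top_unique (hS ▸ h X S)
  · intro h X S Y f hf
    rw [← topology_close] at hf ⊢
    exact h _ hf

/-- At a section `x`, `χ m` is the sieve of arrows along which `x` restricts into the image of `m`,
while `χ (𝟙 B)` is `⊤`. Density thus says that `m` is locally surjective for `j.topology`. -/
theorem isDense_iff {A B : Sheaf J (Type (max u v))} (m : A ⟶ B) [Mono m] :
    j.IsDense m ↔ ∀ (X : C) (x : B.obj.obj (op X)),
      (Subfunctor.range m.hom).sieveOfSection x ∈ j.topology X := by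
  have h₁ : ∀ (X : C) (x : B.obj.obj (op X)),
      sieve (((Sheaf.classifier J).χ m).hom.app (op X) x) =
        (Subfunctor.range m.hom).sieveOfSection x := fun X x => by
    ext Y f
    exact sieve_χ_iff m x f
  have h₂ : ∀ (X : C) (x : B.obj.obj (op X)),
      sieve (((Sheaf.classifier J).χ (𝟙 B)).hom.app (op X) x) = ⊤ := fun X x => by
    ext Y f
    simp only [Sieve.top_apply, iff_true]
    exact (sieve_χ_iff (𝟙 B) x f).2 ⟨_, rfl⟩
  have h₃ : ∀ (X : C) (x : B.obj.obj (op X)),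
      sieve (((Sheaf.classifier J).χ m ≫ j.hom).hom.app (op X) x) =
        j.closure X ((Subfunctor.range m.hom).sieveOfSection x) := fun X x => by
    rw [← h₁]
    exact sieve_hom j _
  simp only [mem_topology_iff, ← h₃]
  constructor
  · intro h X x
    rw [show _ ≫ _ = _ from h, h₂]
  · intro h
    exact hom_ext_sieve fun X x => (h X x).trans (h₂ X x).symm

/-! ### From finer topologies to local operators -/

/-- The closure under a finer topology, as an endomorphism of the subobject classifier. -/
def closeHom {J' : GrothendieckTopology C} (h : J ≤ J') :
    (Sheaf.classifier J).Ω ⟶ (Sheaf.classifier J).Ω where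
  hom :=
    -- A `J'`-closed sieve is `J`-closed because `J ≤ J'`, so the value is again a section of `Ω`.
    { app X := ↾fun x => closedSection X.unop (J'.close (sieve x)) fun _ f hf =>
        J'.close_isClosed _ f (h _ hf)
      naturality X Y f := by
        ext x
        exact sieve_ext (J'.pullback_close f.unop (sieve x)) }

theorem close_inf (J' : GrothendieckTopology C) {X : C} (S T : Sieve X) :
    J'.close (S ⊓ T) = J'.close S ⊓ J'.close T := by
  refine le_antisymm (le_inf (J'.monotone_close inf_le_left) (J'.monotone_close inf_le_right)) ?_
  exact fun Y f hf => J'.arrow_intersect f S T hf.1 hf.2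

/-- The local operator given by a finer topology. -/
noncomputable def ofTopology {J' : GrothendieckTopology C} (h : J ≤ J') :
    LocalOperator (Sheaf.classifier J) where
  hom := closeHom h
  truth_hom := hom_ext_sieve fun X _ => (J'.close_eq_top_iff_mem ⊤).2 (J'.top_mem X)
  hom_hom := hom_ext_sieve fun _ x => J'.close_close (sieve x)
  and_hom := hom_ext_sieve fun X p => by
    have m₁ := congr(sieve (($(prod.map_fst (closeHom h) (closeHom h))).hom.app (op X) p))
    have m₂ := congr(sieve (($(prod.map_snd (closeHom h) (closeHom h))).hom.app (op X) p))
    refine Eq.trans ?_ (sieve_and _).symm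
    refine Eq.trans ?_ (congrArg₂ _ m₁ m₂).symm
    refine (congrArg J'.close (sieve_and p)).trans (close_inf _ _ _)

theorem topology_ofTopology {J' : GrothendieckTopology C} (h : J ≤ J') :
    (ofTopology h).topology = J' := by
  ext X S
  rw [mem_topology_iff]
  change J'.close (J.close S) = ⊤ ↔ _
  rw [← J'.close_eq_top_iff_mem]
  have : J'.close (J.close S) = J'.close S :=
    le_antisymm (J'.le_close_of_isClosed (fun Y f hf => h _ hf) (J'.close_isClosed S))
      (J'.monotone_close (J.le_close S))
  rw [this]

/-! ### Comparison of the two notions of sheaf -/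

/-- A sheaf for the topology of a local operator is a sheaf for the local operator. -/
theorem isSheaf_of_isSheaf_topology {F : Sheaf J (Type (max u v))}
    (hF : Presheaf.IsSheaf j.topology F.obj) : j.isSheaf F := by
  intro A X m _ hm f
  rw [isDense_iff] at hm
  -- A dense monomorphism is injective and locally surjective, hence every `j.topology`-sheaf sees
  -- it as an isomorphism.
  have hW : j.topology.W m.hom := by
    rw [GrothendieckTopology.W_iff_isLocallyBijective]
    have : Mono m.hom := (Sheaf.Hom.mono_iff_presheaf_mono _ _ _).1 inferInstance
    refine ⟨Presheaf.isLocallyInjective_of_injective _ _ fun Y =>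
      (mono_iff_injective (m.hom.app Y)).1 inferInstance, ⟨fun {U} s => hm U s⟩⟩
  obtain ⟨g, hg⟩ := (hW F.obj hF).2 f.hom
  refine ⟨⟨g⟩, ?_, fun g' hg' => ?_⟩
  · ext : 1
    exact hg
  · ext : 1
    exact (hW F.obj hF).1 ((congrArg (·.hom) hg').trans hg.symm)

/-- Over a subcanonical site, a sheaf for a local operator is a sheaf for its topology. -/
theorem isSheaf_topology_of_isSheaf [J.Subcanonical] {F : Sheaf J (Type (max u v))}
    (hF : j.isSheaf F) : Presheaf.IsSheaf j.topology F.obj := by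
  rw [isSheaf_iff_isSheaf_of_type]
  intro X S hS
  have hFJ := (isSheaf_iff_isSheaf_of_type _ _).1 F.property
  let Y : Sheaf J (Type (max u v)) := (GrothendieckTopology.uliftYoneda.{u} J).obj X
  have hY := (isSheaf_iff_isSheaf_of_type _ _).1 Y.property
  -- The sieve `S` is a subpresheaf of `y X`, which is a `J`-sheaf by subcanonicity. Sheafifying `S`
  -- inside `y X` produces a subobject `m` to which the `j`-sheaf condition applies.
  let G : Subfunctor Y.obj :=
    { obj := fun Z => {f | S f.down}
      map := fun g f hf => S.downward_closed hf g.unop }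
  let A : Sheaf J (Type (max u v)) :=
    ⟨(G.sheafify J).toFunctor, (isSheaf_iff_isSheaf_of_type _ _).2 (G.sheafify_isSheaf hY)⟩
  let m : A ⟶ Y := ⟨(G.sheafify J).ι⟩
  have : Mono m := (sheafToPresheaf J _).mono_of_mono_map (inferInstanceAs (Mono (G.sheafify J).ι))
  have hm : j.IsDense m := by
    rw [isDense_iff]
    intro Z z
    refine j.topology.superset_covering ?_ (j.topology.pullback_stable z.down hS)
    -- The arrows restricting `z` into the image of `m` include the pullback of `S` along `z`.
    intro W f hf
    exact ⟨⟨Y.obj.map f.op z, G.le_sheafify J _ hf⟩, rfl⟩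
  intro x hx
  -- A compatible family on `S` is a map out of the subpresheaf, and by Yoneda its amalgamations are
  -- the extensions of that map to `y X`.
  let φ : G.toFunctor ⟶ F.obj :=
    { app Z := ↾fun f => x f.1.down f.2
      naturality Z W g := by
        ext f
        exact (Presieve.compatible_iff_sieveCompatible _).1 hx f.1.down g.unop f.2 }
  let ψ (t : F.obj.obj (op X)) : Y ⟶ F := ⟨uliftYonedaEquiv.{u}.symm t⟩
  have hφ : ∀ t : F.obj.obj (op X), x.IsAmalgamation t ↔
      Subfunctor.homOfLe (G.le_sheafify J) ≫ (m ≫ ψ t).hom = φ := by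
    intro t
    constructor
    · intro ht
      ext Z f
      exact ht f.1.down f.2
    · intro ht Z f hf
      exact congr(($ht).app (op Z) ⟨⟨f⟩, hf⟩)
  obtain ⟨g, hg, hg'⟩ := hF m hm ⟨G.sheafifyLift φ hFJ⟩
  have hψ : ψ (uliftYonedaEquiv.{u} g.hom) = g := by
    ext : 1
    exact uliftYonedaEquiv.{u}.symm_apply_apply g.hom
  refine ⟨uliftYonedaEquiv.{u} g.hom, (hφ _).2 ?_, fun t ht => ?_⟩
  · rw [hψ, hg]
    exact G.to_sheafifyLift φ hFJ
  · rw [← hg' (ψ t)]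
    · exact (uliftYonedaEquiv.{u}.apply_symm_apply t).symm
    · ext : 1
      exact G.to_sheafify_lift_unique hFJ _ _
        (((hφ t).1 ht).trans (G.to_sheafifyLift φ hFJ).symm)

/-- Over a subcanonical site, the sheaves for a local operator are the sheaves for its topology. -/
theorem isSheaf_iff [J.Subcanonical] (F : Sheaf J (Type (max u v))) :
    j.isSheaf F ↔ Presheaf.IsSheaf j.topology F.obj :=
  ⟨j.isSheaf_topology_of_isSheaf, j.isSheaf_of_isSheaf_topology⟩

end LocalOperator

namespace FilterSet

/-! ### Restrictions and finite sums of filters -/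

/-- The restriction of a filter to a subset of its underlying set. -/
def restrict (X : FilterSet.{u}) (A : Set X.carrier) : FilterSet.{u} where
  carrier := X.carrier
  Idx := X.Idx
  inhabited := X.inhabited
  base i := X.base i ∩ A
  directed i j := by
    obtain ⟨k, hk⟩ := X.directed i j
    exact ⟨k, fun x hx => ⟨⟨(hk hx.1).1, hx.2⟩, (hk hx.1).2, hx.2⟩⟩

/-- The inclusion of a restriction. -/
noncomputable def restrictι (X : FilterSet.{u}) (A : Set X.carrier) :
    PartialMap (X.restrict A) X where
  dom := X.inhabited.some
  toFun x := x.1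
  continuous j := by
    obtain ⟨k, hk⟩ := X.directed X.inhabited.some j
    exact ⟨k, fun x hx => ⟨⟨(hk hx.1).1, hx.2⟩, (hk hx.1).2⟩⟩

theorem exists_comp_restrictι {X Y : FilterSet.{u}} (A : Set X.carrier) (a : PartialMap Y X)
    (i : Y.Idx) (h : ∀ y ∈ Y.base i, ∀ hy : y ∈ Y.base a.dom, a.toFun ⟨y, hy⟩ ∈ A) :
    ∃ g : Y ⟶ X.restrict A, g ≫ (X.restrictι A).germ = a.germ := by
  obtain ⟨n, hn⟩ := Y.directed i a.dom
  let g : PartialMap Y (X.restrict A) :=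
    { dom := n
      toFun y := a.toFun ⟨y.1, (hn y.2).2⟩
      continuous j := by
        obtain ⟨k, hk⟩ := a.continuous j
        obtain ⟨l, hl⟩ := Y.directed n k
        exact ⟨l, fun y hy => ⟨(hl hy).1, (hk y (hl hy).2).2, h _ (hn (hl hy).1).1 _⟩⟩ }
  refine ⟨g.germ, ?_⟩
  rw [germ_comp, germ_eq_iff]
  obtain ⟨l, hl⟩ := Y.directed (g.comp (X.restrictι A)).dom a.dom
  exact ⟨l, fun y hy => ⟨(hl hy).1, (hl hy).2, rfl⟩⟩

/-- The sum of a family of filters. -/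
def sigma {ι : Type} (G : ι → FilterSet.{u}) : FilterSet.{u} where
  carrier := Σ k, (G k).carrier
  Idx := ∀ k, (G k).Idx
  inhabited := ⟨fun k => (G k).inhabited.some⟩
  base i := {p | p.2 ∈ (G p.1).base (i p.1)}
  directed i j := by
    choose n hn using fun k => (G k).directed (i k) (j k)
    exact ⟨n, fun p hp => hn p.1 hp⟩

/-- The map out of a sum with given components. -/
def sigmaDesc {ι : Type} {G : ι → FilterSet.{u}} {X : FilterSet.{u}}
    (b : ∀ k, PartialMap (G k) X) : PartialMap (sigma G) X where
  dom k := (b k).dom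
  toFun p := (b p.1.1).toFun ⟨p.1.2, p.2⟩
  continuous j := by
    choose n hn using fun k => (b k).continuous j
    exact ⟨n, fun p hp => hn p.1 p.2 hp⟩

/-- A summand, as a restriction of the sum, maps to the corresponding filter. -/
noncomputable def sigmaProj {ι : Type} (G : ι → FilterSet.{u}) (k : ι) :
    PartialMap ((sigma G).restrict {p | p.1 = k}) (G k) where
  dom := (sigma G).inhabited.some
  toFun p := (p.2.2 : p.1.1 = k) ▸ p.1.2
  continuous j := by
    classical
    obtain ⟨n, hn⟩ := (G k).directed ((sigma G).inhabited.some k) j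
    -- Only the `k`-th summand survives the restriction, so only the `k`-th index needs shrinking.
    refine ⟨Function.update (sigma G).inhabited.some k n, ?_⟩
    rintro ⟨l, x⟩ ⟨hx, h⟩
    obtain rfl : l = k := h
    have hx : x ∈ (G l).base n := by
      rw [← Function.update_self (β := fun k => (G k).Idx) l n (sigma G).inhabited.some]
      exact hx
    exact ⟨⟨(hn hx).1, rfl⟩, (hn hx).2⟩

/-- This puts every summand of the sum into the pullback, along `sigmaDesc b`, of a sieve containing
all `b k`. -/
theorem restrictι_comp_sigmaDesc {ι : Type} {G : ι → FilterSet.{u}} {X : FilterSet.{u}}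
    (b : ∀ k, PartialMap (G k) X) (k : ι) :
    ((sigma G).restrictι {p | p.1 = k}).germ ≫ (sigmaDesc b).germ =
      (sigmaProj G k).germ ≫ (b k).germ := by
  rw [germ_comp, germ_comp, germ_eq_iff]
  obtain ⟨n, hn⟩ := FilterSet.directed _ (((sigma G).restrictι {p | p.1 = k}).comp
    (sigmaDesc b)).dom ((sigmaProj G k).comp (b k)).dom
  refine ⟨n, ?_⟩
  rintro ⟨l, x⟩ hx
  refine ⟨(hn hx).1, (hn hx).2, ?_⟩
  obtain rfl : l = k := hx.2
  rfl

theorem sigmaDesc_covers {ι : Type} {G : ι → FilterSet.{u}} {X : FilterSet.{u}}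
    (b : ∀ k, PartialMap (G k) X) (h : JointlyCovers G fun k => (b k).germ) :
    JointlyCovers (fun _ : Unit => sigma G) (fun _ => (sigmaDesc b).germ) := by
  refine (jointlyCovers_germ_iff (fun _ : Unit => sigmaDesc b)).2 fun j => ?_
  obtain ⟨i, hi⟩ := (jointlyCovers_germ_iff b).1 h (j ())
  refine ⟨i, fun x hx => ?_⟩
  obtain ⟨k, y, hy, hy', rfl⟩ := Set.mem_iUnion.1 (hi hx)
  exact Set.mem_iUnion.2 ⟨(), ⟨k, y⟩, hy, hy', rfl⟩

/-! ### Generation of `K` by `K₁` and splittings -/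

/-- A form of transitivity: it suffices that `S` covers locally, after pullback along the arrows of
a covering sieve. -/
theorem mem_of_close_mem {C : Type u} [Category.{v} C] {J : GrothendieckTopology C} {X : C}
    {S : Sieve X} (h : J.close S ∈ J X) : S ∈ J X := by
  rwa [← J.close_eq_top_iff_mem, J.close_close, J.close_eq_top_iff_mem] at h

/-- A topology contains `K` if it contains `K₁` and the coverings of filters by a subset and its
complement. -/
theorem K_le_of_split {J : GrothendieckTopology FilterSet.{u}} (h₁ : K₁ ≤ J)
    (hJ : ∀ (X : FilterSet.{u}) (A : Set X.carrier) (S : Sieve X), S (X.restrictι A).germ →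
      S (X.restrictι Aᶜ).germ → S ∈ J X) : K ≤ J := by
  classical
  -- Finitely many subsets covering a base set are split off one at a time. With none left, the
  -- filter is non-proper and the empty sieve already covers in `K₁`.
  have fin : ∀ {ι : Type} (s : Finset ι) (X : FilterSet.{u}) (U : ι → Set X.carrier) (S : Sieve X)
      (i : X.Idx), X.base i ⊆ ⋃ k ∈ s, U k → (∀ k ∈ s, S (X.restrictι (U k)).germ) → S ∈ J X := by
    intro ι s
    induction s using Finset.induction_on with
    | empty =>
      intro X U S i hi _
      exact h₁ _ ((mem_K₁_iff S).2 (Or.inr ⟨i, Set.subset_empty_iff.1 (by simpa using hi)⟩))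
    | insert a s _ ih =>
      intro X U S i hi hS
      refine mem_of_close_mem (hJ X (U a) _ ?_ ?_)
      · exact J.le_close S _ (hS a (Finset.mem_insert_self a s))
      · refine ih (X.restrict (U a)ᶜ) U _ i (fun x hx => ?_) fun k hk => ?_
        · have := hi hx.1
          simp only [Finset.mem_insert, Set.iUnion_iUnion_eq_or_left] at this
          exact this.resolve_left hx.2
        -- Restricting to the complement of `U a` and then to `U k` factors through the restriction
        -- of `X` to `U k`.
        · obtain ⟨g, hg⟩ := exists_comp_restrictι (U k)
            (((X.restrict (U a)ᶜ).restrictι (U k)).comp (X.restrictι (U a)ᶜ))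
            (X.inhabited.some) fun y hy _ => hy.2
          change S (((X.restrict (U a)ᶜ).restrictι (U k)).germ ≫ (X.restrictι (U a)ᶜ).germ)
          rw [germ_comp, ← hg]
          exact S.downward_closed (hS k (Finset.mem_insert_of_mem hk)) g
  rintro X S ⟨ι, _, G, β, h, hS⟩
  choose b hb using fun k => exists_germ (β k)
  obtain rfl : (fun k => (b k).germ) = β := funext hb
  refine mem_of_close_mem (h₁ _ ((mem_K₁_iff _).2 (Or.inl ⟨sigma G, (sigmaDesc b).germ,
    sigmaDesc_covers b h, ?_⟩)))
  cases nonempty_fintype ι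
  refine fin Finset.univ (sigma G) (fun k => {p | p.1 = k}) _ (sigma G).inhabited.some
    (fun p _ => by simp) fun k _ => ?_
  change S (_ ≫ _)
  rw [restrictι_comp_sigmaDesc]
  exact S.downward_closed (hS k) _

/-! ### The constant maps to `2` -/

/-- The constant map to `2` with a given value. -/
noncomputable def constMap (X : FilterSet.{u}) (b : ULift.{u} Bool) :
    X ⟶ simple (ULift.{u} Bool) :=
  simplePUnitIsTerminal.from X ≫ simpleMap fun _ => b

theorem comp_constMap {X Y : FilterSet.{u}} (f : X ⟶ Y) (b : ULift.{u} Bool) :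
    f ≫ Y.constMap b = X.constMap b := by
  rw [constMap, constMap, ← Category.assoc]
  congr 1
  exact simplePUnitIsTerminal.hom_ext _ _

theorem germ_eq_constMap_iff {X : FilterSet.{u}} (a : PartialMap X (simple (ULift.{u} Bool)))
    (b : ULift.{u} Bool) : a.germ = X.constMap b ↔
      ∃ i, ∀ x ∈ X.base i, ∃ h : x ∈ X.base a.dom, a.toFun ⟨x, h⟩ = b := by
  obtain ⟨t, ht⟩ := exists_germ (simplePUnitIsTerminal.from X)
  rw [constMap, ← ht, simpleMap, germ_comp, germ_eq_iff]
  constructor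
  · rintro ⟨i, hi⟩
    exact ⟨i, fun x hx => let ⟨h, _, e⟩ := hi x hx; ⟨h, e⟩⟩
  · rintro ⟨i, hi⟩
    obtain ⟨n, hn⟩ := X.directed i (t.comp _).dom
    exact ⟨n, fun x hx => let ⟨h, e⟩ := hi x (hn hx).1; ⟨h, (hn hx).2, e⟩⟩

theorem exists_base_eq_empty {X : FilterSet.{u}} (h : X.constMap ⟨false⟩ = X.constMap ⟨true⟩) :
    ∃ i, X.base i = ∅ := by
  obtain ⟨a, ha⟩ := exists_germ (X.constMap ⟨false⟩)
  obtain ⟨i, hi⟩ := (germ_eq_constMap_iff a _).1 ha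
  obtain ⟨k, hk⟩ := (germ_eq_constMap_iff a _).1 (ha.trans h)
  obtain ⟨n, hn⟩ := X.directed i k
  refine ⟨n, Set.eq_empty_of_forall_notMem fun x hx => ?_⟩
  obtain ⟨_, e⟩ := hi x (hn hx).1
  obtain ⟨_, e'⟩ := hk x (hn hx).2
  exact Bool.false_ne_true (congrArg ULift.down (e.symm.trans e'))

/-- The sieve on `2` of the maps which are constant. -/
def constSieve : Sieve (simple (ULift.{u} Bool)) where
  arrows X f := ∃ b, f = X.constMap b
  downward_closed := by
    rintro _ _ _ ⟨b, rfl⟩ g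
    exact ⟨b, comp_constMap g b⟩

/-- The indicator function of a subset. -/
noncomputable def indicator (X : FilterSet.{u}) (A : Set X.carrier) :
    PartialMap X (simple (ULift.{u} Bool)) where
  dom := X.inhabited.some
  toFun x := ⟨@decide (x.1 ∈ A) (Classical.dec _)⟩
  continuous _ := ⟨_, fun _ hx => ⟨hx, trivial⟩⟩

/-- A map into `X` along which the indicator of `A` becomes constant sends some base set into `A` or
into `Aᶜ`, so it factors through one of the two restrictions. -/
theorem K_le_of_constSieve_mem {J : GrothendieckTopology FilterSet.{u}} (h₁ : K₁ ≤ J)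
    (hJ : constSieve ∈ J _) : K ≤ J := by
  refine K_le_of_split h₁ fun X A S hA hA' => ?_
  refine J.superset_covering ?_ (J.pullback_stable (X.indicator A).germ hJ)
  rintro Y f ⟨⟨b⟩, hb⟩
  obtain ⟨a, rfl⟩ := exists_germ f
  rw [germ_comp, germ_eq_constMap_iff] at hb
  obtain ⟨i, hi⟩ := hb
  cases b
  · obtain ⟨g, hg⟩ := exists_comp_restrictι Aᶜ a i fun y hy hy' hA => by
      obtain ⟨_, e⟩ := hi y hy
      exact @of_decide_eq_false _ (Classical.dec _) (congrArg ULift.down e) hA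
    rw [← hg]
    exact S.downward_closed hA' g
  · obtain ⟨g, hg⟩ := exists_comp_restrictι A a i fun y hy hy' => by
      obtain ⟨_, e⟩ := hi y hy
      exact @of_decide_eq_true _ (Classical.dec _) (congrArg ULift.down e)
    rw [← hg]
    exact S.downward_closed hA g

theorem constSieve_mem_K : constSieve.{u} ∈ K (simple (ULift.{u} Bool)) := by
  choose b hb using fun k : Bool => exists_germ ((simple PUnit.{u + 1}).constMap ⟨k⟩)
  refine (mem_K_iff _).2 ⟨Bool, inferInstance, _, fun k => (b k).germ,
    (jointlyCovers_germ_iff b).2 fun j => ⟨PUnit.unit, fun x _ => ?_⟩, fun k => ⟨⟨k⟩, hb k⟩⟩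
  obtain ⟨i, hi⟩ := (germ_eq_constMap_iff _ _).1 (hb x.down)
  obtain ⟨h, e⟩ := hi PUnit.unit trivial
  exact Set.mem_iUnion.2 ⟨x.down, PUnit.unit, trivial, h, e⟩

/-! ### The image of `2` in `y 2` -/

/-- The subsheaf of `y 2` of constant maps. -/
def constSubfunctor : Subfunctor (yU.obj (simple (ULift.{u} Bool))).obj where
  obj _ := {f | constSieve f.down}
  map g _ hf := constSieve.downward_closed hf g.unop

/-- A map that becomes constant after a single cover is constant, by cancellation, and on a
non-proper filter all maps agree. Covers with several members would break this, since the constants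
may differ. -/
theorem constSubfunctor_isSheaf : Presieve.IsSheaf K₁ constSubfunctor.{u}.toFunctor := by
  rw [Subfunctor.isSheaf_iff _ ((isSheaf_iff_isSheaf_of_type _ _).1
    (yU.obj (simple (ULift.{u} Bool))).property)]
  intro X f hf
  rcases (mem_K₁_iff _).1 hf with ⟨G, β, hβ, b, hb⟩ | ⟨i, hi⟩
  · refine ⟨b, cancel_of_covers β hβ ?_⟩
    rw [comp_constMap]
    exact hb
  · exact ⟨⟨false⟩, (existsUnique_hom_of_base_eq_empty hi _).unique trivial trivial⟩

/-- The sheaf of constant maps to `2`. -/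
noncomputable def constSheaf : ToposU.{u} :=
  ⟨constSubfunctor.toFunctor, (isSheaf_iff_isSheaf_of_type _ _).2 constSubfunctor_isSheaf⟩

/-- The inclusion of the sheaf of constant maps. -/
noncomputable def constSheafι : constSheaf.{u} ⟶ yU.obj (simple (ULift.{u} Bool)) :=
  ⟨constSubfunctor.ι⟩

instance : Mono constSheafι.{u} :=
  (sheafToPresheaf _ _).mono_of_mono_map (inferInstanceAs (Mono constSubfunctor.ι))

theorem yPoint_app (b : ULift.{u} Bool) (X : FilterSet.{u}) (x : (⊤_ ToposU.{u}).obj.obj (op X)) :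
    (yPoint b).hom.app (op X) x = ULift.up (X.constMap b) := by
  refine ULift.ext _ _ ?_
  change ULift.down ((yOneIsTerminal.from (⊤_ ToposU.{u})).hom.app (op X) x) ≫
    simpleMap (fun _ => b) = _
  rw [constMap]
  exact congrArg (· ≫ _) (simplePUnitIsTerminal.hom_ext _ _)

/-- The global elements of the sheaf of constant maps. -/
noncomputable def constPoint (b : ULift.{u} Bool) : ⊤_ ToposU.{u} ⟶ constSheaf :=
  ⟨constSubfunctor.lift (yPoint b).hom (by
    rintro X _ ⟨x, rfl⟩
    exact ⟨b, congrArg ULift.down (yPoint_app b X.unop x)⟩)⟩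

/-- The section of the terminal sheaf. -/
noncomputable def star (X : FilterSet.{u}ᵒᵖ) : (⊤_ ToposU.{u}).obj.obj X :=
  (terminal.from (yU.obj (simple PUnit))).hom.app X (ULift.up (simplePUnitIsTerminal.from X.unop))

theorem eq_star {X : FilterSet.{u}ᵒᵖ} (x : (⊤_ ToposU.{u}).obj.obj X) : x = star X := by
  have h : ∀ y : (⊤_ ToposU.{u}).obj.obj X, (terminal.from (yU.obj (simple PUnit))).hom.app X
      ((yOneIsTerminal.from (⊤_ ToposU.{u})).hom.app X y) = y := fun y =>
    congr(($(terminal.hom_ext (yOneIsTerminal.from (⊤_ ToposU.{u}) ≫ terminal.from _)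
      (𝟙 _))).hom.app X y)
  rw [← h x]
  refine congrArg _ (ULift.ext _ _ (simplePUnitIsTerminal.hom_ext _ _))

/-- Equal constants force the filter to be non-proper, hence covered by the empty sieve. -/
theorem section_unique {F : ToposU.{u}} {X : FilterSet.{u}}
    (h : X.constMap ⟨false⟩ = X.constMap ⟨true⟩) (x y : F.obj.obj (op X)) : x = y :=
  (((isSheaf_iff_isSheaf_of_type _ _).1 F.property) ⊥
    ((mem_K₁_iff _).2 (Or.inr (exists_base_eq_empty h)))).isSeparatedFor.ext
      fun _ _ hf => hf.elim

/-- The section of the sheaf of constant maps with a given value. -/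
noncomputable def constSection (X : FilterSet.{u}ᵒᵖ) (b : ULift.{u} Bool) :
    constSheaf.{u}.obj.obj X :=
  ⟨⟨X.unop.constMap b⟩, b, rfl⟩

theorem eq_constSection {X : FilterSet.{u}ᵒᵖ} (f : constSheaf.{u}.obj.obj X) :
    ∃ b, f = constSection X b := by
  obtain ⟨⟨f⟩, b, hf⟩ := f
  exact ⟨b, Subtype.ext (ULift.ext _ _ hf)⟩

theorem map_constSection {X Y : FilterSet.{u}ᵒᵖ} (g : X ⟶ Y) (b : ULift.{u} Bool) :
    constSheaf.obj.map g (constSection X b) = constSection Y b :=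
  Subtype.ext (ULift.ext _ _ (comp_constMap g.unop b))

theorem constPoint_app (b : ULift.{u} Bool) {X : FilterSet.{u}ᵒᵖ}
    (x : (⊤_ ToposU.{u}).obj.obj X) : (constPoint b).hom.app X x = constSection X b :=
  Subtype.ext (yPoint_app b X.unop x)

/-- The value of a constant map is determined on a proper filter; on a non-proper one, sections of
`F` are unique. Quantifying over all possible values makes the choice of `y` harmless. -/
theorem exists_constDesc {F : ToposU.{u}} (t : ULift.{u} Bool → (⊤_ ToposU.{u} ⟶ F))
    (X : FilterSet.{u}ᵒᵖ) (f : constSheaf.{u}.obj.obj X) :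
    ∃ y : F.obj.obj X, ∀ b, f = constSection X b → y = (t b).hom.app X (star X) := by
  obtain ⟨b, rfl⟩ := eq_constSection f
  refine ⟨(t b).hom.app X (star X), fun b' h => ?_⟩
  have h : X.unop.constMap b = X.unop.constMap b' := congrArg (fun z => z.1.down) h
  obtain ⟨b⟩ := b
  obtain ⟨b'⟩ := b'
  cases b <;> cases b'
  · rfl
  · exact section_unique h _ _
  · exact section_unique h.symm _ _
  · rfl

/-- The map out of the sheaf of constant maps with given values. -/
noncomputable def constDesc {F : ToposU.{u}} (t : ULift.{u} Bool → (⊤_ ToposU.{u} ⟶ F)) :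
    constSheaf ⟶ F where
  hom :=
    { app X := ↾fun f => (exists_constDesc t X f).choose
      naturality X Y g := by
        ext f
        obtain ⟨b, rfl⟩ := eq_constSection f
        change (exists_constDesc t Y _).choose = F.obj.map g (exists_constDesc t X _).choose
        rw [(exists_constDesc t X _).choose_spec b rfl,
          (exists_constDesc t Y _).choose_spec b (map_constSection g b),
          ← NatTrans.naturality_apply]
        exact congrArg _ (eq_star _).symm }

theorem constDesc_constSection {F : ToposU.{u}} (t : ULift.{u} Bool → (⊤_ ToposU.{u} ⟶ F))
    (X : FilterSet.{u}ᵒᵖ) (b : ULift.{u} Bool) :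
    (constDesc t).hom.app X (constSection X b) = (t b).hom.app X (star X) :=
  (exists_constDesc t X _).choose_spec b rfl

theorem constPoint_desc {F : ToposU.{u}} (t : ULift.{u} Bool → (⊤_ ToposU.{u} ⟶ F))
    (b : ULift.{u} Bool) : constPoint b ≫ constDesc t = t b := by
  ext X x
  change (constDesc t).hom.app X ((constPoint b).hom.app X x) = _
  rw [constPoint_app, constDesc_constSection, ← eq_star x]
  rfl

theorem constSheaf_hom_ext {F : ToposU.{u}} {g g' : constSheaf ⟶ F}
    (h : ∀ b, constPoint b ≫ g = constPoint b ≫ g') : g = g' := by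
  ext X f
  obtain ⟨b, rfl⟩ := eq_constSection f
  rw [← constPoint_app b (star X)]
  exact congr(($(h b)).hom.app X (star X))

/-- The sheaf of constant maps is the coproduct `2 = 1 + 1`. -/
noncomputable def twoIso : (⊤_ ToposU.{u}) ⨿ (⊤_ ToposU.{u}) ≅ constSheaf where
  hom := coprod.desc (constPoint ⟨false⟩) (constPoint ⟨true⟩)
  inv := constDesc fun b => bif b.down then coprod.inr else coprod.inl
  hom_inv_id := by
    ext1
    · rw [coprod.inl_desc_assoc, constPoint_desc, Category.comp_id]
      rfl
    · rw [coprod.inr_desc_assoc, constPoint_desc, Category.comp_id]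
      rfl
  inv_hom_id := constSheaf_hom_ext fun b => by
    rw [← Category.assoc, constPoint_desc, Category.comp_id]
    obtain ⟨b⟩ := b
    cases b
    · exact coprod.inl_desc _ _
    · exact coprod.inr_desc _ _

theorem twoIso_hom_ι : twoIso.hom ≫ constSheafι.{u} = twoToYTwo := by
  rw [twoIso, coprod.desc_comp]
  rfl

instance mono_twoToYTwo : Mono twoToYTwo.{u} := by
  rw [← twoIso_hom_ι]
  infer_instance

theorem range_twoToYTwo : Subfunctor.range twoToYTwo.{u}.hom = constSubfunctor := by
  ext X f
  constructor
  · rintro ⟨x, rfl⟩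
    rw [← twoIso_hom_ι]
    exact (twoIso.hom.hom.app X x).2
  · intro hf
    refine ⟨twoIso.inv.hom.app X ⟨f, hf⟩, ?_⟩
    have := congr(($(Iso.inv_hom_id_assoc twoIso constSheafι)).hom.app X ⟨f, hf⟩)
    rw [twoIso_hom_ι] at this
    exact this

/-- The identity of `2` is the generic section of `y 2`: its sieve is `constSieve`, and the sieve of
any other section `f` is the pullback of `constSieve` along `f`. -/
theorem isDense_twoToYTwo_iff (j : LocalOperator classifierU.{u}) :
    j.IsDense twoToYTwo ↔ K ≤ j.topology := by
  rw [LocalOperator.isDense_iff, range_twoToYTwo]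
  constructor
  · intro h
    refine K_le_of_constSieve_mem j.le_topology ?_
    refine j.topology.superset_covering ?_ (h _ (ULift.up (𝟙 _)))
    intro X f hf
    have hf : constSieve (f ≫ 𝟙 _) := hf
    rwa [Category.comp_id] at hf
  · intro h X f
    exact h _ (K.pullback_stable f.down constSieve_mem_K)

/-! ### The equivalence and the main theorem -/

/-- The sheaves for a local operator with topology `K` are the sheaves for `K`. -/
theorem exists_equivalence (j : LocalOperator classifierU.{u}) (hj : j.topology = K) :
    ∃ e : j.Sh ≌ ToposN.{u}, Nonempty (e.functor ⋙ inclusionNU ≅ j.isSheaf.ι) := by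
  have hs : ∀ F : ToposU.{u}, j.isSheaf F ↔ Presheaf.IsSheaf K F.obj := fun F => by
    rw [← hj]
    exact j.isSheaf_iff F
  -- Both sides are full subcategories of presheaves cut out by the same condition, so the functors
  -- keep the underlying presheaf and the unit and counit are identities.
  let G : ToposN.{u} ⥤ j.Sh := j.isSheaf.lift inclusionNU fun F => (hs _).2 F.property
  let H : j.Sh ⥤ ToposN.{u} := ObjectProperty.lift _ (j.isSheaf.ι ⋙ sheafToPresheaf _ _)
    fun F => (hs _).1 F.property
  let e : j.Sh ≌ ToposN.{u} :=
    { functor := H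
      inverse := G
      unitIso := Iso.refl _
      counitIso := Iso.refl _ }
  exact ⟨e, ⟨Iso.refl _⟩⟩

end FilterSet

theorem mainTheorem8 :
    ∃ _ : Mono FilterSet.twoToYTwo.{u},
      (∃ j : LocalOperator FilterSet.classifierU.{u},
        IsLeast {j | j.IsDense FilterSet.twoToYTwo} j) ∧
      ∀ j : LocalOperator FilterSet.classifierU.{u},
        IsLeast {j | j.IsDense FilterSet.twoToYTwo} j →
          ∃ e : j.Sh ≌ FilterSet.ToposN.{u},
            Nonempty (e.functor ⋙ FilterSet.inclusionNU ≅ j.isSheaf.ι) := by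
  refine ⟨FilterSet.mono_twoToYTwo, ?_, fun j hj => FilterSet.exists_equivalence j ?_⟩
  · refine ⟨LocalOperator.ofTopology FilterSet.K₁_le_K, ?_, fun j hj => ?_⟩
    · exact (FilterSet.isDense_twoToYTwo_iff _).2 (LocalOperator.topology_ofTopology _).ge
    · rw [LocalOperator.le_iff_topology_le, LocalOperator.topology_ofTopology]
      exact (FilterSet.isDense_twoToYTwo_iff j).1 hj
  -- Density gives `K ≤ j.topology`; minimality against the operator of `K` gives the other
  -- inequality.
  · refine le_antisymm ?_ ((FilterSet.isDense_twoToYTwo_iff j).1 hj.1)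
    rw [← LocalOperator.topology_ofTopology FilterSet.K₁_le_K, ← LocalOperator.le_iff_topology_le]
    exact hj.2 ((FilterSet.isDense_twoToYTwo_iff _).2 (LocalOperator.topology_ofTopology _).ge)
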